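/- Let $q$ be a prime power and let $1 \le R \le k \le m$ be integers. A (Delsarte rank-metric) code is an $\mathbb{F}_q$-linear subspace $\mathcal{C} \subseteq \mathrm{Mat}(k\times m,\mathbb{F}_q)$. Put $\mathrm{maxrk}(\mathcal{C})=\max\{\mathrm{rk}(M): M\in\mathcal{C}\}$ and, for $\mathcal{C}\neq 0$, $\mathrm{minrk}(\mathcal{C})=\min\{\mathrm{rk}(M): M\in\mathcal{C},\ M\ne 0\}$. The code $\mathcal{C}$ is a Delsarte optimal (MRD) code if $\mathcal{C}\ne 0$ and $\dim_{\mathbb{F}_q}(\mathcal{C}) = m(k-\mathrm{minrk}(\mathcal{C})+1)$; a code $\mathcal{A}\subseteq \mathrm{Mat}(k\times m,\mathbb{F}_q)$ is a Delsarte optimal anticode if $\dim_{\mathbb{F}_q}(\mathcal{A}) = m\cdot\mathrm{maxrk}(\mathcal{A})$. For a nonzero code $\mathcal{C}$ and $1\le r\le \dim_{\mathbb{F}_q}(\mathcal{C})$, the $r$-th Delsarte generalized weight of $\mathcal{C}$ is $$a_r(\mathcal{C}) = \frac1m \min\{\dim_{\mathbb{F}_q}(\mathcal{A}) : \mathcal{A}\subseteq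 \mathrm{Mat}(k\times m,\mathbb{F}_q) \text{ is a Delsarte optimal anticode and } \dim_{\mathbb{F}_q}(\mathcal{A}\cap\mathcal{C})\ge r\}.$$ Let $\mathcal{C} \subseteq \mathrm{Mat}(k\times m,\mathbb{F}_q)$ be a code with $\dim_{\mathbb{F}_q}(\mathcal{C})=mR$. The following are equivalent: 1. $\mathcal{C}$ is a Delsarte optimal code; 2. $a_1(\mathcal{C}) = k-R+1$; 3. $a_r(\mathcal{C}) = k-R+\lceil r/m\rceil$ for all integers $1\le r\le mR$. In particular, the Delsarte generalized weights of a Delsarte optimal code $\mathcal{C}$ depend only on $k$, $m$ and $\mathrm{minrk}(\mathcal{C})$: if $\mathcal{C}$ is a Delsarte optimal code in $\mathrm{Mat}(k\times m,\mathbb{F}_q)$ and $\mathcal{C}'$ is a Delsarte optimal code in $\mathrm{Mat}(k\times m,\mathbb{F}_{q'})$ for a prime power $q'$, with $\mathrm{minrk}(\mathcal{C}')=\mathrm{minrk}(\mathcal{C})$, then $\dim_{\mathbb{F}_{q'}}(\mathcal{C}')=\dim_{\mathbb{F}_q}(\mathcal{C})$ and $a_r(\mathcal{C}')=a_r(\mathcal{C})$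 for all $1\le r\le \dim_{\mathbb{F}_q}(\mathcal{C})$. -/

import Mathlib

namespace RankMetric

variable {F : Type*} [Field F] {k m : ℕ}

/-- A Delsarte (rank-metric) code of size `k × m` over `F`: an `F`-linear subspace of the space
of `k × m` matrices over `F`. -/
abbrev DelsarteCode (F : Type*) [Field F] (k m : ℕ) : Type _ :=
  Submodule F (Matrix (Fin k) (Fin m) F)

/-- The minimum rank of a code: the least positive rank of a codeword
(meaningful for nonzero codes). -/
noncomputable def minrk (C : DelsarteCode F k m) : ℕ :=
  sInf {d : ℕ | ∃ M ∈ C, 0 < M.rank ∧ M.rank = d}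

/-- The maximum rank of a code: the greatest rank of a codeword
(the set is nonempty, as `0 ∈ C`, and bounded, as ranks are at most `k`). -/
noncomputable def maxrk (C : DelsarteCode F k m) : ℕ :=
  sSup {d : ℕ | ∃ M ∈ C, M.rank = d}

/-- A Delsarte optimal (MRD) code: a nonzero code attaining the Singleton-like bound
`dim C ≤ m (k - minrk C + 1)`, which holds when `1 ≤ k ≤ m`. -/
def IsOptimalCode (C : DelsarteCode F k m) : Prop :=
  C ≠ ⊥ ∧ (Module.finrank F C : ℤ) = m * (k - minrk C + 1)

/-- A Delsarte optimal anticode: a code attaining the bound `dim A ≤ m * maxrk A`,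
which holds when `1 ≤ k ≤ m`. -/
def IsOptimalAnticode (A : DelsarteCode F k m) : Prop :=
  Module.finrank F A = m * maxrk A

/-- The `r`-th Delsarte generalized weight of a code (for `1 ≤ r ≤ dim C`): `1 / m` times the
minimum dimension of an optimal anticode `A` such that `dim (A ∩ C) ≥ r`. -/
noncomputable def genWeight (C : DelsarteCode F k m) (r : ℕ) : ℚ :=
  (1 / m : ℚ) * (sInf {n : ℕ | ∃ A : DelsarteCode F k m, IsOptimalAnticode A ∧
    r ≤ Module.finrank F (A ⊓ C : DelsarteCode F k m) ∧ Module.finrank F A = n} : ℕ)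

end RankMetric

/-! The heart is an exact intersection formula: if `A` is an optimal anticode of maximum rank `u`,
`C` has dimension `m * e` with all nonzero ranks above `k - e`, and `u + e ≥ k`, then `A + C` is the
whole space, so `dim (A ∩ C) = m (u + e - k)`. All weights follow from this by counting.

The sum is full because a matrix orthogonal to both summands vanishes: duals of MRD codes are MRD
(`IsMRD.dualCode`), so its rank would exceed `e`, while `IsOptimalAnticode.rank_dualCode_le` bounds
it by `k - u`. That bound needs every matrix of rank above `k - u` to lie in an MRD code of
dimension `m * u`; a suitably twisted Gabidulin code provides one (`exists_gabidulin`).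

Conversely, the first weight is the minimum rank, which together with the dimension decides
optimality. -/

namespace RankMetric

open Polynomial Module

/-! ### Linearized polynomials over a finite field -/

section Linearized

variable (F : Type*) [Field F] [Finite F] {L : Type*} [Field L] [Algebra F L]

/-- The `F`-linear endomorphism `x ↦ ∑ i, p.coeff i * x ^ (q ^ i)` of `L`, where `q = #F`. -/
noncomputable def linearized : L[X] →ₗ[L] (L →ₗ[F] L) :=
  letI := Fintype.ofFinite F
  Polynomial.lsum fun i =>
    LinearMap.toSpanSingleton L (L →ₗ[F] L) ((FiniteField.frobeniusAlgHom F L) ^ i).toLinearMap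

theorem linearized_apply (p : L[X]) (x : L) :
    linearized F p x = p.sum fun i a => a * x ^ (Nat.card F ^ i) := by
  let := Fintype.ofFinite F
  have h (i : ℕ) : ((FiniteField.frobeniusAlgHom F L) ^ i) x = x ^ (Fintype.card F ^ i) := by
    rw [AlgHom.coe_pow, FiniteField.coe_frobeniusAlgHom, pow_iterate]
  simp only [linearized, Polynomial.lsum_apply, Polynomial.sum, LinearMap.sum_apply,
    LinearMap.toSpanSingleton_apply, LinearMap.smul_apply, AlgHom.toLinearMap_apply, h,
    smul_eq_mul, Nat.card_eq_fintype_card]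

theorem finrank_ker_linearized_le [Module.Finite F L] {p : L[X]} (hp : p ≠ 0) :
    finrank F (LinearMap.ker (linearized F p)) ≤ p.natDegree := by
  classical
  have hq : 1 < Nat.card F := Finite.one_lt_card
  have : Finite L := Module.finite_of_finite F
  -- The ordinary polynomial inducing the same map; it has at most `q ^ deg p` roots, and the kernel
  -- is a set of `q ^ dim` roots.
  set P : L[X] := p.sum fun i a => C a * X ^ (Nat.card F ^ i) with hP
  have heval (x : L) : P.eval x = linearized F p x := by
    rw [linearized_apply, hP, Polynomial.sum, Polynomial.sum, eval_finsetSum]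
    simp
  have hcoeff : P.coeff (Nat.card F ^ p.natDegree) = p.leadingCoeff := by
    rw [hP, Polynomial.sum, finsetSum_coeff]
    simp only [coeff_C_mul, coeff_X_pow, Nat.pow_right_inj hq]
    simp [hp]
  have hP0 : P ≠ 0 := by
    intro h
    rw [h, coeff_zero] at hcoeff
    exact hp (leadingCoeff_eq_zero.1 hcoeff.symm)
  have hdeg : P.natDegree ≤ Nat.card F ^ p.natDegree := by
    refine natDegree_sum_le_of_forall_le _ _ fun i hi => ?_
    exact (natDegree_C_mul_X_pow_le _ _).trans
      (Nat.pow_le_pow_right hq.le (le_natDegree_of_mem_supp _ hi))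
  have hfin := Fintype.ofFinite (LinearMap.ker (linearized F p))
  have hcard : Nat.card (LinearMap.ker (linearized F p)) ≤ P.natDegree := by
    have := card_le_degree_of_subset_roots
      (Z := (LinearMap.ker (linearized F p) : Set L).toFinite.toFinset) (p := P) (by
        intro x hx
        simp only [Finset.mem_val, Set.Finite.mem_toFinset, SetLike.mem_coe,
          LinearMap.mem_ker] at hx
        rw [mem_roots hP0, IsRoot, heval, hx])
    rwa [← Nat.card_eq_card_finite_toFinset] at this
  rw [Module.natCard_eq_pow_finrank (K := F)] at hcard
  exact (Nat.pow_le_pow_iff_right hq).1 (hcard.trans hdeg)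

theorem exists_linearized_eq_zero [Module.Finite F L] (W : Submodule F L) :
    ∃ p : L[X], p ≠ 0 ∧ p.natDegree ≤ finrank F W ∧ W ≤ LinearMap.ker (linearized F p) := by
  set j := finrank F W
  let b := finBasis F W
  let ev : degreeLT L (j + 1) →ₗ[L] (Fin j → L) :=
    LinearMap.pi fun i => (LinearMap.applyₗ' L (b i : L)).comp
      ((linearized F).comp (degreeLT L (j + 1)).subtype)
  have hd : finrank L (degreeLT L (j + 1)) = j + 1 := by
    rw [(degreeLTEquiv L (j + 1)).finrank_eq, finrank_fin_fun]
  have : Module.Finite L (degreeLT L (j + 1)) := Module.Finite.equiv (degreeLTEquiv L (j + 1)).symm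
  -- There are `j + 1` free coefficients against `j` linear conditions, one per basis vector of `W`.
  obtain ⟨⟨p, hpd⟩, hp, hp0⟩ := (Submodule.ne_bot_iff _).1
    (LinearMap.ker_ne_bot_of_finrank_lt (f := ev) (by rw [hd, finrank_fin_fun]; omega))
  have hp0' : p ≠ 0 := fun h => hp0 (Subtype.ext h)
  refine ⟨p, hp0', ?_, ?_⟩
  · have := (natDegree_lt_iff_degree_lt hp0').2 (mem_degreeLT.1 hpd)
    omega
  · have hb (i : Fin j) : linearized F p (b i : L) = 0 := congrFun (LinearMap.mem_ker.1 hp) i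
    have h0 : (linearized F p).comp W.subtype = 0 := b.ext fun i => hb i
    intro x hx
    exact LinearMap.congr_fun h0 ⟨x, hx⟩

end Linearized

/-! ### Auxiliary linear algebra -/

section LinearAlgebra

variable {K V W Y : Type*} [Field K] [AddCommGroup V] [Module K V] [AddCommGroup W] [Module K W]
  [AddCommGroup Y] [Module K Y]

theorem exists_linearEquiv_comp_eq_of_ker_eq [Module.Finite K V] [Module.Finite K W]
    [Module.Finite K Y]
    (hd : finrank K W = finrank K Y) {f : V →ₗ[K] W} {g : V →ₗ[K] Y}
    (h : LinearMap.ker f = LinearMap.ker g) :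
    ∃ T : W ≃ₗ[K] Y, T.toLinearMap ∘ₗ f = g := by
  obtain ⟨A, hA⟩ := Submodule.exists_isCompl (LinearMap.range f)
  obtain ⟨B, hB⟩ := Submodule.exists_isCompl (LinearMap.range g)
  let e₁ : LinearMap.range f ≃ₗ[K] LinearMap.range g :=
    f.quotKerEquivRange.symm ≪≫ₗ Submodule.quotEquivOfEq _ _ h ≪≫ₗ g.quotKerEquivRange
  have hAB : finrank K A = finrank K B := by
    have h1 := Submodule.finrank_add_eq_of_isCompl hA
    have h2 := Submodule.finrank_add_eq_of_isCompl hB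
    have h3 := e₁.finrank_eq
    omega
  let e₂ : A ≃ₗ[K] B := LinearEquiv.ofFinrankEq A B hAB
  refine ⟨(Submodule.prodEquivOfIsCompl _ _ hA).symm ≪≫ₗ (e₁.prodCongr e₂) ≪≫ₗ
    Submodule.prodEquivOfIsCompl _ _ hB, ?_⟩
  ext v
  have h1 : (Submodule.prodEquivOfIsCompl _ _ hA).symm (f v)
      = ((⟨f v, LinearMap.mem_range_self f v⟩ : LinearMap.range f), 0) :=
    Submodule.prodEquivOfIsCompl_symm_apply_left _ _ hA ⟨f v, LinearMap.mem_range_self f v⟩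
  have h2 : e₁ ⟨f v, LinearMap.mem_range_self f v⟩ = ⟨g v, LinearMap.mem_range_self g v⟩ := by
    have : f.quotKerEquivRange.symm ⟨f v, LinearMap.mem_range_self f v⟩ =
        Submodule.Quotient.mk v := by
      rw [LinearEquiv.symm_apply_eq]; rfl
    simp only [e₁, LinearEquiv.trans_apply, this]
    rfl
  simp [h1, h2]

theorem exists_submodule_le_finrank_eq [Module.Finite K V] (U : Submodule K V) {n : ℕ}
    (hn : n ≤ finrank K U) : ∃ W ≤ U, finrank K W = n := by
  obtain ⟨f, hf⟩ := exists_linearIndependent_of_le_finrank hn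
  refine ⟨Submodule.span K (Set.range fun i => (f i : V)), ?_, ?_⟩
  · rw [Submodule.span_le]
    rintro _ ⟨i, rfl⟩
    exact (f i).2
  · exact (finrank_span_eq_card (hf.map' U.subtype U.ker_subtype)).trans (Fintype.card_fin n)

theorem finrank_map_of_injective {f : V →ₗ[K] W} (hf : Function.Injective f)
    (U : Submodule K V) : finrank K (U.map f) = finrank K U :=
  (Submodule.equivMapOfInjective f hf U).finrank_eq.symm

end LinearAlgebra

/-- A linear map with kernel of dimension less than `e` lies in a space of linear maps of
dimension `e * dim Y` all of whose nonzero members have kernels of dimension less than `e`. -/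
theorem exists_gabidulin {F V Y : Type*} [Field F] [Finite F] [AddCommGroup V] [Module F V]
    [AddCommGroup Y] [Module F Y] [Module.Finite F V] [Module.Finite F Y]
    (hVY : finrank F V ≤ finrank F Y) (g : V →ₗ[F] Y) {e : ℕ}
    (hg : finrank F (LinearMap.ker g) < e) (he : e ≤ finrank F V) :
    ∃ G : Submodule F (V →ₗ[F] Y), g ∈ G ∧ finrank F G = finrank F Y * e ∧
      ∀ f ∈ G, f ≠ 0 → finrank F (LinearMap.ker f) < e := by
  obtain ⟨p, hp⟩ := CharP.exists F
  have : Fact p.Prime := ⟨CharP.char_is_prime F p⟩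
  have : NeZero (finrank F Y) := ⟨by omega⟩
  let L := FiniteField.Extension F p (finrank F Y)
  have hL : finrank F L = finrank F Y := FiniteField.finrank_extension F p (finrank F Y)
  obtain ⟨α, hα⟩ := (finrank_le_iff_exists_linearMap (R := F) (M := V) (M' := L)).1
    (by rw [hL]; exact hVY)
  have hker (P : L[X]) (hP : P ≠ 0) :
      finrank F (LinearMap.ker (linearized F P ∘ₗ α)) ≤ P.natDegree := by
    refine le_trans ?_ (finrank_ker_linearized_le F hP)
    rw [LinearMap.ker_comp, ← finrank_map_of_injective hα]
    exact Submodule.finrank_mono (Submodule.map_comap_le _ _)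
  -- A polynomial killing `α (ker g)` has, by the degree bound, no larger kernel along `α`. So `P ∘
  -- α` and `g` differ only by an isomorphism `T` of targets, and the Gabidulin code transported by
  -- `T` contains `g`.
  obtain ⟨P, hP0, hPd, hPW⟩ := exists_linearized_eq_zero F ((LinearMap.ker g).map α)
  have hW : finrank F ((LinearMap.ker g).map α) = finrank F (LinearMap.ker g) :=
    finrank_map_of_injective hα _
  have hkg : LinearMap.ker (linearized F P ∘ₗ α) = LinearMap.ker g := by
    symm
    refine Submodule.eq_of_le_of_finrank_le (fun v hv => hPW (Submodule.mem_map_of_mem hv)) ?_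
    have := hker P hP0
    omega
  obtain ⟨T, hT⟩ := exists_linearEquiv_comp_eq_of_ker_eq hL hkg
  let Ψ : degreeLT L e →ₗ[F] (V →ₗ[F] Y) :=
    { toFun := fun Q => T.toLinearMap ∘ₗ linearized F (Q : L[X]) ∘ₗ α
      map_add' := fun Q Q' => by ext; simp
      map_smul' := fun c Q => by
        ext v
        simp }
  have hΨker (Q : degreeLT L e) (hQ : Q ≠ 0) : finrank F (LinearMap.ker (Ψ Q)) < e := by
    have hQ' : (Q : L[X]) ≠ 0 := fun h => hQ (Subtype.ext h)
    have h1 : LinearMap.ker (Ψ Q) = LinearMap.ker (linearized F (Q : L[X]) ∘ₗ α) :=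
      LinearEquiv.ker_comp T _
    rw [h1]
    exact (hker _ hQ').trans_lt ((natDegree_lt_iff_degree_lt hQ').2 (mem_degreeLT.1 Q.2))
  have hΨ : Function.Injective Ψ := by
    rw [injective_iff_map_eq_zero]
    intro Q hQ
    by_contra hne
    have := hΨker Q hne
    rw [hQ, LinearMap.ker_zero, finrank_top] at this
    omega
  refine ⟨LinearMap.range Ψ, ⟨⟨P, ?_⟩, hT⟩, ?_, ?_⟩
  · rw [mem_degreeLT, ← natDegree_lt_iff_degree_lt hP0]
    omega
  · rw [LinearMap.finrank_range_of_inj hΨ, ← finrank_mul_finrank F L,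
      (degreeLTEquiv L e).finrank_eq, finrank_fin_fun, hL]
  · rintro _ ⟨Q, rfl⟩ hQ
    exact hΨker Q fun h => hQ (by rw [h, map_zero])

/-! ### Duality for the entrywise form -/

section Matrices

variable {F : Type*} [Field F] {k m : ℕ}

/-- The entrywise bilinear form `∑ i j, M i j * N i j` on matrices. -/
def entryForm (F : Type*) [Field F] (k m : ℕ) :
    LinearMap.BilinForm F (Matrix (Fin k) (Fin m) F) :=
  LinearMap.mk₂ F (fun M N => ∑ j, ∑ i, M i j * N i j)
    (fun M M' N => by simp [add_mul, Finset.sum_add_distrib])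
    (fun c M N => by simp [Finset.mul_sum, mul_assoc])
    (fun M N N' => by simp [mul_add, Finset.sum_add_distrib])
    (fun c M N => by simp [Finset.mul_sum, mul_left_comm])

theorem entryForm_apply (M N : Matrix (Fin k) (Fin m) F) :
    entryForm F k m M N = ∑ j, ∑ i, M i j * N i j := rfl

theorem entryForm_comm (M N : Matrix (Fin k) (Fin m) F) :
    entryForm F k m M N = entryForm F k m N M := by
  simp only [entryForm_apply, mul_comm]

theorem eq_zero_of_forall_entryForm {N : Matrix (Fin k) (Fin m) F}
    (h : ∀ M, entryForm F k m M N = 0) : N = 0 := by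
  classical
  ext i j
  have := h (Matrix.single i j 1)
  rw [entryForm_apply, Finset.sum_eq_single j, Finset.sum_eq_single i] at this
  · simpa using this
  · intro b _ hb
    simp [hb.symm]
  · simp
  · intro b _ hb
    simp [hb.symm]
  · simp

theorem entryForm_nondegenerate : (entryForm F k m).Nondegenerate :=
  ⟨fun N h => eq_zero_of_forall_entryForm fun M => by rw [entryForm_comm]; exact h M,
    fun _ h => eq_zero_of_forall_entryForm h⟩

theorem entryForm_isRefl : (entryForm F k m).IsRefl := fun M N h => by rwa [entryForm_comm]

/-- The dual code with respect to the entrywise bilinear form. -/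
def dualCode (C : DelsarteCode F k m) : DelsarteCode F k m := (entryForm F k m).orthogonal C

theorem finrank_matrix_fin : finrank F (Matrix (Fin k) (Fin m) F) = m * k := by
  rw [finrank_matrix, finrank_self]; simp [mul_comm]

theorem finrank_dualCode (C : DelsarteCode F k m) :
    finrank F (dualCode C) = m * k - finrank F C := by
  rw [dualCode, LinearMap.BilinForm.finrank_orthogonal entryForm_nondegenerate, finrank_matrix_fin]

theorem eq_zero_of_mem_dualCode_of_sup_eq_top {C D : DelsarteCode F k m} (h : C ⊔ D = ⊤)
    {N : Matrix (Fin k) (Fin m) F} (hC : N ∈ dualCode C) (hD : N ∈ dualCode D) : N = 0 := by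
  refine eq_zero_of_forall_entryForm fun M => ?_
  obtain ⟨A, hA, B, hB, rfl⟩ := Submodule.mem_sup.1 (h ▸ Submodule.mem_top : M ∈ C ⊔ D)
  rw [map_add, LinearMap.add_apply, hC A hA, hD B hB, add_zero]

theorem exists_mem_dualCode_of_sup_ne_top {C D : DelsarteCode F k m} (h : C ⊔ D ≠ ⊤) :
    ∃ N ≠ 0, N ∈ dualCode C ∧ N ∈ dualCode D := by
  have hlt := Submodule.finrank_lt h
  rw [finrank_matrix_fin] at hlt
  have hpos : dualCode (C ⊔ D) ≠ ⊥ := by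
    intro h0
    have := finrank_dualCode (C ⊔ D)
    rw [h0, finrank_bot] at this
    omega
  obtain ⟨N, hN, hN0⟩ := (Submodule.ne_bot_iff _).1 hpos
  exact ⟨N, hN0, fun M hM => hN M (Submodule.mem_sup_left hM),
    fun M hM => hN M (Submodule.mem_sup_right hM)⟩

theorem sup_eq_top_of_inf_eq_bot {C D : DelsarteCode F k m} (h : C ⊓ D = ⊥)
    (hd : m * k ≤ finrank F C + finrank F D) : C ⊔ D = ⊤ := by
  apply Submodule.eq_top_of_finrank_eq
  have h1 := Submodule.finrank_sup_add_finrank_inf_eq C D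
  have h2 := Submodule.finrank_le (C ⊔ D)
  rw [finrank_matrix_fin] at *
  rw [h, finrank_bot] at h1
  omega

/-! ### Codes with prescribed column space -/

/-- The code of all matrices whose columns lie in `U`. -/
def supportCode (m : ℕ) (U : Submodule F (Fin k → F)) : DelsarteCode F k m where
  carrier := {M | ∀ j, M.col j ∈ U}
  zero_mem' _ := U.zero_mem
  add_mem' hM hN j := U.add_mem (hM j) (hN j)
  smul_mem' c _ hM j := U.smul_mem c (hM j)

theorem finrank_supportCode (U : Submodule F (Fin k → F)) :
    finrank F (supportCode m U) = m * finrank F U := by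
  let e : supportCode m U ≃ₗ[F] (Fin m → U) :=
    { toFun := fun M j => ⟨M.1.col j, M.2 j⟩
      invFun := fun f => ⟨Matrix.of fun i j => (f j : Fin k → F) i, fun j => (f j).2⟩
      map_add' := fun _ _ => rfl
      map_smul' := fun _ _ => rfl
      left_inv := fun _ => rfl
      right_inv := fun _ => rfl }
  rw [e.finrank_eq, finrank_pi_fintype]
  simp

/-- The span of the columns of a matrix. -/
def colSpace (M : Matrix (Fin k) (Fin m) F) : Submodule F (Fin k → F) :=
  Submodule.span F (Set.range M.col)

theorem finrank_colSpace (M : Matrix (Fin k) (Fin m) F) : finrank F (colSpace M) = M.rank :=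
  M.rank_eq_finrank_span_cols.symm

theorem mem_supportCode_colSpace (M : Matrix (Fin k) (Fin m) F) :
    M ∈ supportCode m (colSpace M) := fun j => Submodule.subset_span ⟨j, rfl⟩

theorem rank_le_of_mem_supportCode {U : Submodule F (Fin k → F)} {M : Matrix (Fin k) (Fin m) F}
    (hM : M ∈ supportCode m U) : M.rank ≤ finrank F U := by
  rw [← finrank_colSpace]
  refine Submodule.finrank_mono (Submodule.span_le.2 ?_)
  rintro _ ⟨j, rfl⟩
  exact hM j

theorem exists_mem_supportCode_rank_eq {U : Submodule F (Fin k → F)} (hU : finrank F U ≤ m) :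
    ∃ M ∈ supportCode m U, M.rank = finrank F U := by
  let b := finBasis F U
  -- The columns are a basis of `U` padded with zeros, which fits because `dim U ≤ m`.
  let v : Fin m → U := fun j => if h : (j : ℕ) < finrank F U then b ⟨j, h⟩ else 0
  have hM : (Matrix.of fun i j => (v j : Fin k → F) i) ∈ supportCode m U := fun j => (v j).2
  refine ⟨_, hM, (rank_le_of_mem_supportCode hM).antisymm ?_⟩
  rw [← finrank_colSpace]
  refine Submodule.finrank_mono ?_
  have hb (i : Fin (finrank F U)) :
      (b i : Fin k → F) ∈ colSpace (Matrix.of fun i j => (v j : Fin k → F) i) := by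
    refine Submodule.subset_span ⟨⟨i, i.2.trans_le hU⟩, ?_⟩
    ext l
    simp [v]
  intro x hx
  rw [← Submodule.coe_mk x hx, ← b.sum_repr ⟨x, hx⟩, Submodule.coe_sum]
  exact Submodule.sum_mem _ fun i _ => Submodule.smul_mem _ _ (hb i)

theorem bddAbove_ranks (A : DelsarteCode F k m) : BddAbove {d : ℕ | ∃ M ∈ A, M.rank = d} :=
  ⟨k, by rintro _ ⟨M, _, rfl⟩; exact M.rank_le_height⟩

theorem rank_le_maxrk {A : DelsarteCode F k m} {M : Matrix (Fin k) (Fin m) F} (hM : M ∈ A) :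
    M.rank ≤ maxrk A :=
  le_csSup (bddAbove_ranks A) ⟨M, hM, rfl⟩

theorem maxrk_le (A : DelsarteCode F k m) : maxrk A ≤ k :=
  csSup_le ⟨_, 0, A.zero_mem, rfl⟩ (by rintro _ ⟨M, _, rfl⟩; exact M.rank_le_height)

theorem maxrk_supportCode {U : Submodule F (Fin k → F)} (hU : finrank F U ≤ m) :
    maxrk (supportCode m U) = finrank F U := by
  obtain ⟨M, hM, hr⟩ := exists_mem_supportCode_rank_eq hU
  refine le_antisymm (csSup_le ⟨_, M, hM, rfl⟩ ?_) (hr ▸ rank_le_maxrk hM)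
  rintro _ ⟨N, hN, rfl⟩
  exact rank_le_of_mem_supportCode hN

theorem isOptimalAnticode_supportCode {U : Submodule F (Fin k → F)} (hU : finrank F U ≤ m) :
    IsOptimalAnticode (supportCode m U) := by
  rw [IsOptimalAnticode, finrank_supportCode, maxrk_supportCode hU]

theorem rank_pos_of_ne_zero {M : Matrix (Fin k) (Fin m) F} (hM : M ≠ 0) : 0 < M.rank := by
  rw [Nat.pos_iff_ne_zero]
  intro h
  have hbot : colSpace M = ⊥ := Submodule.finrank_eq_zero.1 ((finrank_colSpace M).trans h)
  refine hM (Matrix.ext fun i j => ?_)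
  have := mem_supportCode_colSpace M j
  rw [hbot, Submodule.mem_bot] at this
  exact congrFun this i

theorem minrk_le_rank {C : DelsarteCode F k m} {M : Matrix (Fin k) (Fin m) F} (hM : M ∈ C)
    (h0 : M ≠ 0) : minrk C ≤ M.rank :=
  Nat.sInf_le ⟨M, hM, rank_pos_of_ne_zero h0, rfl⟩

theorem exists_rank_eq_minrk {C : DelsarteCode F k m} (hC : C ≠ ⊥) :
    ∃ M ∈ C, M ≠ 0 ∧ M.rank = minrk C := by
  obtain ⟨M, hM, h0⟩ := (Submodule.ne_bot_iff _).1 hC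
  obtain ⟨N, hN, hpos, hr⟩ := Nat.sInf_mem
    (s := {d : ℕ | ∃ M ∈ C, 0 < M.rank ∧ M.rank = d}) ⟨_, M, hM, rank_pos_of_ne_zero h0, rfl⟩
  refine ⟨N, hN, ?_, hr⟩
  rintro rfl
  simp at hpos

/-! ### MRD codes and their intersections with anticodes -/

/-- A code of dimension `m * e` all of whose nonzero members have rank greater than `k - e`. -/
structure IsMRD (e : ℕ) (C : DelsarteCode F k m) : Prop where
  finrank_eq : finrank F C = m * e
  lt_rank : ∀ M ∈ C, M ≠ 0 → k < e + M.rank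

theorem IsMRD.dualCode {e : ℕ} {C : DelsarteCode F k m} (hC : IsMRD e C) (he : e ≤ k) :
    IsMRD (k - e) (dualCode C) := by
  refine ⟨by rw [finrank_dualCode, hC.finrank_eq, Nat.mul_sub], fun N hN hN0 => ?_⟩
  by_contra hlt
  have hNe : N.rank ≤ e := by omega
  -- the orthogonal complement of the column space of `N` for the dot product
  let Z : Submodule F (Fin k → F) := LinearMap.ker N.transpose.mulVecLin
  have hZ : finrank F Z = k - N.rank := by
    have h1 := LinearMap.finrank_range_add_finrank_ker N.transpose.mulVecLin
    have h2 : finrank F (LinearMap.range N.transpose.mulVecLin) = N.rank := N.rank_transpose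
    rw [h2, finrank_fin_fun] at h1
    change finrank F (LinearMap.ker N.transpose.mulVecLin) = _
    omega
  -- Matrices supported on `W` have rank at most `k - e`, so they meet `C` only in zero and
  -- complement it by dimension; `N` is orthogonal to both.
  obtain ⟨W, hWZ, hW⟩ := exists_submodule_le_finrank_eq Z (n := k - e) (by omega)
  have hbot : C ⊓ supportCode m W = ⊥ := by
    rw [Submodule.eq_bot_iff]
    rintro M ⟨hMC, hMW⟩
    by_contra h0
    have h1 := hC.lt_rank M hMC h0
    have h2 := rank_le_of_mem_supportCode hMW
    omega
  have htop := sup_eq_top_of_inf_eq_bot hbot (by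
    rw [hC.finrank_eq, finrank_supportCode, hW, ← mul_add, Nat.add_sub_cancel' he])
  refine hN0 (eq_zero_of_mem_dualCode_of_sup_eq_top htop hN ?_)
  intro M hM
  rw [entryForm_apply]
  refine Finset.sum_eq_zero fun j _ => ?_
  have := congrFun (LinearMap.mem_ker.1 (hWZ (hM j))) j
  simpa only [Matrix.mulVecLin_apply, Matrix.mulVec, dotProduct, Matrix.transpose_apply,
    Matrix.col_apply, Pi.zero_apply, mul_comm] using this

theorem exists_isMRD_mem [Finite F] (hkm : k ≤ m) {e : ℕ} (he : e ≤ k)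
    {N : Matrix (Fin k) (Fin m) F} (hN : k < e + N.rank) :
    ∃ G : DelsarteCode F k m, IsMRD e G ∧ N ∈ G := by
  -- Transposing makes `F^k` the source, the smaller of the two spaces, so that it embeds in the
  -- degree `m` extension.
  let Θ : Matrix (Fin k) (Fin m) F ≃ₗ[F] ((Fin k → F) →ₗ[F] (Fin m → F)) :=
    Matrix.transposeLinearEquiv _ _ F F ≪≫ₗ Matrix.toLin'
  have hker (M : Matrix (Fin k) (Fin m) F) :
      M.rank + finrank F (LinearMap.ker (Θ M)) = k := by
    have h1 := LinearMap.finrank_range_add_finrank_ker (Θ M)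
    have h2 : finrank F (LinearMap.range (Θ M)) = M.rank := M.rank_transpose
    rwa [h2, finrank_fin_fun] at h1
  obtain ⟨G, hNG, hG, hGk⟩ := exists_gabidulin (by simpa using hkm) (Θ N) (e := e)
    (by have := hker N; omega) (by simpa using he)
  refine ⟨G.comap Θ.toLinearMap, ⟨?_, fun M hM h0 => ?_⟩, hNG⟩
  · rw [← LinearEquiv.finrank_map_eq Θ, Submodule.map_comap_eq_of_surjective Θ.surjective, hG,
      finrank_fin_fun]
  · have := hGk (Θ M) hM (by simpa using h0)
    have := hker M
    omega

/-- A violating `N` lies in an MRD code `G` of dimension `m * maxrk A`. The nonzero ranks of the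
dual of `G` exceed `maxrk A`, so that dual complements `A`; being orthogonal to both, `N` is zero.
-/
theorem IsOptimalAnticode.rank_dualCode_le [Finite F] (hkm : k ≤ m) {A : DelsarteCode F k m}
    (hA : IsOptimalAnticode A) {N : Matrix (Fin k) (Fin m) F} (hN : N ∈ dualCode A) :
    N.rank + maxrk A ≤ k := by
  by_contra! hlt
  have hu := maxrk_le A
  have hN0 : N ≠ 0 := by
    rintro rfl
    rw [Matrix.rank_zero] at hlt
    omega
  obtain ⟨G, hG, hNG⟩ := exists_isMRD_mem hkm hu (N := N) (by omega)
  have hG' := hG.dualCode hu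
  have hbot : A ⊓ dualCode G = ⊥ := by
    rw [Submodule.eq_bot_iff]
    rintro M ⟨hMA, hMG⟩
    by_contra h0
    have h1 := hG'.lt_rank M hMG h0
    have h2 := rank_le_maxrk hMA
    omega
  have htop := sup_eq_top_of_inf_eq_bot hbot (by
    rw [hA, hG'.finrank_eq, ← mul_add, Nat.add_sub_cancel' hu])
  exact hN0 (eq_zero_of_mem_dualCode_of_sup_eq_top htop hN
    (LinearMap.BilinForm.le_orthogonal_orthogonal entryForm_isRefl hNG))

theorem IsMRD.finrank_inf_add [Finite F] (hkm : k ≤ m) {e : ℕ} (he : e ≤ k)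
    {A C : DelsarteCode F k m} (hA : IsOptimalAnticode A) (hC : IsMRD e C)
    (hAe : k ≤ maxrk A + e) :
    finrank F (A ⊓ C : DelsarteCode F k m) + m * k = m * (maxrk A + e) := by
  have htop : A ⊔ C = ⊤ := by
    by_contra h
    obtain ⟨N, hN0, hNA, hNC⟩ := exists_mem_dualCode_of_sup_ne_top h
    have h1 := hA.rank_dualCode_le hkm hNA
    have h2 := (hC.dualCode he).lt_rank N hNC hN0
    omega
  have := Submodule.finrank_sup_add_finrank_inf_eq A C
  rw [htop, finrank_top, finrank_matrix_fin, hA, hC.finrank_eq] at this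
  rw [mul_add]
  omega

/-! ### Generalized weights -/

theorem genWeight_eq_of_isLeast (hm : 0 < m) {C : DelsarteCode F k m} {r u : ℕ}
    (h : ∃ A : DelsarteCode F k m, IsOptimalAnticode A ∧
      r ≤ finrank F (A ⊓ C : DelsarteCode F k m) ∧ maxrk A = u)
    (hle : ∀ A : DelsarteCode F k m, IsOptimalAnticode A →
      r ≤ finrank F (A ⊓ C : DelsarteCode F k m) → u ≤ maxrk A) :
    genWeight C r = u := by
  have hleast : IsLeast {n : ℕ | ∃ A : DelsarteCode F k m, IsOptimalAnticode A ∧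
      r ≤ finrank F (A ⊓ C : DelsarteCode F k m) ∧ finrank F A = n} (m * u) := by
    constructor
    · obtain ⟨A, hA, hr, rfl⟩ := h
      exact ⟨A, hA, hr, hA⟩
    · rintro _ ⟨A, hA, hr, rfl⟩
      rw [hA]
      exact Nat.mul_le_mul_left m (hle A hA hr)
  have hm' : (m : ℚ) ≠ 0 := by positivity
  rw [genWeight, hleast.csInf_eq]
  push_cast
  field_simp

/-- The matrices supported on the column space of a codeword of least rank form an optimal anticode
attaining the minimum. -/
theorem genWeight_one (hm : 0 < m) {C : DelsarteCode F k m} (hC : C ≠ ⊥) :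
    genWeight C 1 = minrk C := by
  apply genWeight_eq_of_isLeast hm
  · obtain ⟨M, hM, h0, hr⟩ := exists_rank_eq_minrk hC
    have hU : finrank F (colSpace M) ≤ m := by
      rw [finrank_colSpace]
      exact M.rank_le_width
    refine ⟨supportCode m (colSpace M), isOptimalAnticode_supportCode hU, ?_, ?_⟩
    · rw [Submodule.one_le_finrank_iff]
      exact (Submodule.ne_bot_iff _).2 ⟨M, ⟨mem_supportCode_colSpace M, hM⟩, h0⟩
    · rw [maxrk_supportCode hU, finrank_colSpace, hr]
  · intro A _ hr
    rw [Submodule.one_le_finrank_iff] at hr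
    obtain ⟨M, ⟨hMA, hMC⟩, h0⟩ := (Submodule.ne_bot_iff _).1 hr
    exact (minrk_le_rank hMC h0).trans (rank_le_maxrk hMA)

/-- The hypotheses on `s` say `s = ⌈r / m⌉`; intersections with large enough anticodes have
dimension a multiple of `m`, hence the rounding up. -/
theorem IsMRD.genWeight_eq [Finite F] (hkm : k ≤ m) {e r s : ℕ} (he : e ≤ k) (hs : s ≤ e)
    {C : DelsarteCode F k m} (hC : IsMRD e C) (hr : m * s < r + m) (hrs : r ≤ m * s)
    (hr0 : 0 < r) : genWeight C r = (k - e + s : ℕ) := by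
  apply genWeight_eq_of_isLeast (by lia)
  · obtain ⟨U, -, hU⟩ := exists_submodule_le_finrank_eq (⊤ : Submodule F (Fin k → F))
      (n := k - e + s) (by rw [finrank_top, finrank_fin_fun]; omega)
    have hUm : finrank F U ≤ m := by omega
    have hA := isOptimalAnticode_supportCode hUm
    refine ⟨supportCode m U, hA, ?_, by rw [maxrk_supportCode hUm, hU]⟩
    have h := hC.finrank_inf_add hkm he hA (by rw [maxrk_supportCode hUm]; omega)
    rw [maxrk_supportCode hUm, hU, show k - e + s + e = s + k by omega, mul_add] at h
    omega
  · intro A hA hrA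
    have hpos : (A ⊓ C : DelsarteCode F k m) ≠ ⊥ :=
      Submodule.one_le_finrank_iff.1 (by omega)
    -- A nonzero common codeword forces `maxrk A > k - e`, which puts `A` in the range of the
    -- intersection formula.
    obtain ⟨M, ⟨hMA, hMC⟩, h0⟩ := (Submodule.ne_bot_iff _).1 hpos
    have h1 := hC.lt_rank M hMC h0
    have h2 := rank_le_maxrk hMA
    obtain ⟨t, ht⟩ := Nat.exists_eq_add_of_le (show k ≤ maxrk A + e by omega)
    have h := hC.finrank_inf_add hkm he hA (by omega)
    rw [ht, mul_add] at h
    have h3 : m * s < m * (t + 1) := by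
      rw [mul_add]
      omega
    have := Nat.lt_of_mul_lt_mul_left h3
    omega

theorem ne_bot_of_finrank_eq {R : ℕ} (hm : 0 < m) (hR : 1 ≤ R) {C : DelsarteCode F k m}
    (hC : finrank F C = m * R) : C ≠ ⊥ := by
  rintro rfl
  rw [finrank_bot] at hC
  have := Nat.mul_pos hm hR
  omega

theorem isOptimalCode_iff_minrk_eq {R : ℕ} (hm : 0 < m) (hR : 1 ≤ R) {C : DelsarteCode F k m}
    (hC : finrank F C = m * R) : IsOptimalCode C ↔ minrk C + R = k + 1 := by
  have hm' : (m : ℤ) ≠ 0 := by exact_mod_cast hm.ne'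
  rw [IsOptimalCode, hC, Nat.cast_mul, mul_right_inj' hm']
  refine ⟨fun h => by omega, fun h => ⟨ne_bot_of_finrank_eq hm hR hC, by omega⟩⟩

theorem IsOptimalCode.isMRD {R : ℕ} (hm : 0 < m) (hR : 1 ≤ R) {C : DelsarteCode F k m}
    (h : IsOptimalCode C) (hC : finrank F C = m * R) : IsMRD R C := by
  refine ⟨hC, fun M hM h0 => ?_⟩
  have h1 := (isOptimalCode_iff_minrk_eq hm hR hC).1 h
  have h2 := minrk_le_rank hM h0
  omega

theorem IsOptimalCode.genWeight_eq [Finite F] {R : ℕ} (hR : 1 ≤ R) (hRk : R ≤ k) (hkm : k ≤ m)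
    {C : DelsarteCode F k m} (h : IsOptimalCode C) (hC : finrank F C = m * R) {r : ℕ}
    (hr : 1 ≤ r) (hrm : r ≤ m * R) :
    genWeight C r = (k : ℚ) - R + (⌈(r : ℚ) / (m : ℚ)⌉ : ℤ) := by
  have hm : 0 < m := by omega
  have hmQ : (0 : ℚ) < m := by exact_mod_cast hm
  set s := ⌈(r : ℚ) / (m : ℚ)⌉₊ with hs
  have hsceil : ((⌈(r : ℚ) / (m : ℚ)⌉ : ℤ) : ℚ) = s := by
    rw [hs, natCast_ceil_eq_intCast_ceil (by positivity)]
  have hle : (r : ℚ) / m ≤ s := Nat.le_ceil _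
  have hlt : (s : ℚ) < r / m + 1 := Nat.ceil_lt_add_one (by positivity)
  have hsR : s ≤ R := Nat.ceil_le.2 (by
    rw [div_le_iff₀ hmQ, mul_comm]
    exact_mod_cast hrm)
  have h1 : r ≤ m * s := by
    rw [div_le_iff₀ hmQ, mul_comm] at hle
    exact_mod_cast hle
  have h2 : m * s < r + m := by
    have : (m : ℚ) * s < r + m := by
      have := mul_lt_mul_of_pos_left hlt hmQ
      rwa [mul_add, mul_div_cancel₀ _ hmQ.ne', mul_one] at this
    exact_mod_cast this
  rw [(h.isMRD hm hR hC).genWeight_eq hkm hRk hsR h2 h1 hr, hsceil]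
  push_cast [hRk]
  ring

end Matrices

end RankMetric

theorem corollary6p4 {F : Type*} [Field F] [Finite F] {k m R : ℕ}
    (hR : 1 ≤ R) (hRk : R ≤ k) (hkm : k ≤ m)
    (C : RankMetric.DelsarteCode F k m) (hC : Module.finrank F C = m * R) :
    List.TFAE [
      RankMetric.IsOptimalCode C,
      RankMetric.genWeight C 1 = (k : ℚ) - R + 1,
      ∀ r : ℕ, 1 ≤ r → r ≤ m * R →
        RankMetric.genWeight C r = (k : ℚ) - R + (⌈(r : ℚ) / (m : ℚ)⌉ : ℤ)] ∧
    -- the weights of an optimal code depend only on `k`, `m` and the minimum rank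
    (RankMetric.IsOptimalCode C →
      ∀ (F' : Type*) [Field F'] [Finite F'] (C' : RankMetric.DelsarteCode F' k m),
        RankMetric.IsOptimalCode C' → RankMetric.minrk C' = RankMetric.minrk C →
          Module.finrank F' C' = Module.finrank F C ∧
          ∀ r : ℕ, 1 ≤ r → r ≤ Module.finrank F C →
            RankMetric.genWeight C' r = RankMetric.genWeight C r) := by
  have hm : 0 < m := by omega
  constructor
  · tfae_have 1 → 3 := fun h r hr hrm => h.genWeight_eq hR hRk hkm hC hr hrm
    tfae_have 3 → 2 := fun h => by
      have hceil : ⌈((1 : ℕ) : ℚ) / (m : ℚ)⌉ = 1 := by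
        have hmQ : (1 : ℚ) ≤ m := by exact_mod_cast hm
        rw [Int.ceil_eq_iff, Nat.cast_one]
        constructor
        · simpa using by linarith
        · rw [Int.cast_one]
          exact div_le_one_of_le₀ hmQ (by linarith)
      rw [h 1 le_rfl (Nat.mul_pos hm hR), hceil, Int.cast_one]
    tfae_have 2 → 1 := fun h => by
      rw [RankMetric.genWeight_one hm (RankMetric.ne_bot_of_finrank_eq hm hR hC)] at h
      rw [RankMetric.isOptimalCode_iff_minrk_eq hm hR hC]
      have : (RankMetric.minrk C : ℚ) + R = k + 1 := by linarith
      exact_mod_cast this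
    tfae_finish
  · intro h F' _ _ C' h' hmin
    -- Equality in the Singleton-like bound expresses the dimension through `k`, `m` and the minimum
    -- rank, so both codes share the same `R`.
    have hdim : Module.finrank F' C' = Module.finrank F C := by
      have h1 := h.2
      have h2 := h'.2
      rw [hmin, ← h1] at h2
      exact_mod_cast h2
    refine ⟨hdim, fun r hr hrC => ?_⟩
    rw [hC] at hrC hdim
    rw [h.genWeight_eq hR hRk hkm hC hr hrC, h'.genWeight_eq hR hRk hkm hdim hr hrC]
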